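/- **Theorem (Construction of classical states).** Let $n\ge 2$. *The target poset.* Let $\Delta^n$ be the set of all $x=(x_1,\dots,x_n)\in[0,1]^n$ with $\sum_i x_i=1$. For $x,y\in\Delta^n$ put $x\sqsubseteq y$ iff there is a permutation $\sigma$ of $\{1,\dots,n\}$ such that $i\mapsto x_{\sigma(i)}$ and $i\mapsto y_{\sigma(i)}$ are both (weakly) decreasing and $x_{\sigma(i)}\,y_{\sigma(i+1)}\le x_{\sigma(i+1)}\,y_{\sigma(i)}$ for all $1\le i\le n-1$. *The construction.* Let $A^*_{0,1}$ be the poset of subsets of $\{1,\dots,n\}$ other than $\emptyset$ and $\{1,\dots,n\}$, ordered by reverse inclusion. Every maximal chain of $A^*_{0,1}$ has exactly $n-1$ elements, and we write it in decreasing order $\vec a=(a_1\sqsupset\dots\sqsupset a_{n-1})$, i.e. $a_1\subsetneq\dots\subsetneq a_{n-1}$. Consider the pairs $\vec a\cdot\vec\gamma$, where $\vec a$ is a maximal chain of $A^*_{0,1}$ and $\vec\gamma=(\gamma_1,\dots,\gamma_{n-1})\in[0,1]^{n-1}$ satisfies: $\gamma_i=1$ and $i<j$ imply $\gamma_j=1$.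 Put $\vec a\cdot\vec\gamma\sqsubseteq\vec b\cdot\vec\varphi$ iff $\vec a=\vec b$ and $\gamma_i\le\varphi_i$ for all $i$. Put $\vec a\cdot\vec\gamma\sim\vec b\cdot\vec\varphi$ iff $\vec\gamma=\vec\varphi$ and $a_i=b_i$ for every $i$ with $0<\gamma_i<1$ and also for the smallest $i$ with $\gamma_i=1$, if there is such an $i$. Let $S_n$ be the set of $\sim$-equivalence classes, with $X\sqsubseteq Y$ for $X,Y\in S_n$ iff there are representatives $p\in X$ and $q\in Y$ with $p\sqsubseteq q$. *Conclusion.* $(S_n,\sqsubseteq)$ and $(\Delta^n,\sqsubseteq)$ are partially ordered sets, and they are order-isomorphic. -/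

import Mathlib

namespace EntropicGeometry

/-- The poset `A*₀₁`: remove bottom and top from the bounded poset `A` and reverse the order. -/
abbrev ProperDual (A : Type*) [PartialOrder A] [BoundedOrder A] : Type _ :=
  {a : A // a ≠ ⊥ ∧ a ≠ ⊤}ᵒᵈ

/-- Maximal chains `a₁ ⊐ ⋯ ⊐ aₘ` of length `m` in `A*₀₁`, given by their decreasing enumeration. -/
def MChain (A : Type*) [PartialOrder A] [BoundedOrder A] (m : ℕ) : Type _ :=
  {a : Fin m → ProperDual A // StrictAnti a ∧ IsMaxChain (· ≤ ·) (Set.range a)}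

/-- The `⊤`-closed `Γ`-valued tuples of length `m`. -/
def ClTop (Γ : Type*) [LinearOrder Γ] [BoundedOrder Γ] (m : ℕ) : Type _ :=
  {γ : Fin m → Γ // ∀ i j, i < j → γ i = ⊤ → γ j = ⊤}

/-- The set `[A*₀₁, Γ]` of pairs `a · γ`. -/
abbrev Pairs (A Γ : Type*) [PartialOrder A] [BoundedOrder A] [LinearOrder Γ] [BoundedOrder Γ]
    (m : ℕ) : Type _ :=
  MChain A m × ClTop Γ m

/-- The index set `I(γ) ∪ {ι(γ)}`: the positions whose value is neither `⊥` nor `⊤`, and the first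
position with value `⊤` (if there is one). -/
def activeIndices {Γ : Type*} [LinearOrder Γ] [BoundedOrder Γ] {m : ℕ} (γ : ClTop Γ m) :
    Set (Fin m) :=
  {i | γ.1 i ≠ ⊥ ∧ γ.1 i ≠ ⊤} ∪ {i | IsLeast {j | γ.1 j = ⊤} i}

section

variable (A Γ : Type*) [PartialOrder A] [BoundedOrder A] [LinearOrder Γ] [BoundedOrder Γ] (m : ℕ)

/-- The relation `a · γ ⊑ b · φ` on pairs: same chain, tuples compared pointwise. -/
def pairLE (p q : Pairs A Γ m) : Prop :=
  p.1 = q.1 ∧ ∀ i, p.2.1 i ≤ q.2.1 i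

/-- Pairs are identified when the tuples agree and the chains agree at the active indices. -/
def voidSetoid : Setoid (Pairs A Γ m) where
  r p q := p.2 = q.2 ∧ ∀ i ∈ activeIndices p.2, p.1.1 i = q.1.1 i
  iseqv :=
    { refl := fun _ => ⟨rfl, fun _ _ => rfl⟩
      symm := fun h => ⟨h.1.symm, fun i hi => (h.2 i (h.1.symm ▸ hi)).symm⟩
      trans := fun h k => ⟨h.1.trans k.1, fun i hi => (h.2 i hi).trans (k.2 i (h.1 ▸ hi))⟩ }

/-- The set of equivalence classes of pairs. -/
def States : Type _ := Quotient (voidSetoid A Γ m)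

/-- The relation on classes inherited from `pairLE`: two classes are related iff they have
related representatives. -/
def statesLE (X Y : States A Γ m) : Prop :=
  ∃ p q : Pairs A Γ m, Quotient.mk (voidSetoid A Γ m) p = X ∧
    Quotient.mk (voidSetoid A Γ m) q = Y ∧ pairLE A Γ m p q

end

/-- The Bayesian order on the probability distributions on `n` points. -/
def bayesLE (n : ℕ) (x y : stdSimplex ℝ (Fin n)) : Prop :=
  ∃ σ : Equiv.Perm (Fin n), Antitone (x.1 ∘ σ) ∧ Antitone (y.1 ∘ σ) ∧
    ∀ i j : Fin n, j.1 = i.1 + 1 → x.1 (σ i) * y.1 (σ j) ≤ x.1 (σ j) * y.1 (σ i)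

end EntropicGeometry

/-! A maximal chain of proper subsets is an ordering of the points, up to its initial segments: it
has exactly one member of each size. Read `γᵢ` as the relative drop `1 - x_{σ(i+1)} / x_{σ(i)}` of a
distribution along such an ordering. Multiplying the factors `1 - γᵢ` and normalizing turns a pair
into a distribution, and every distribution arises by sorting it.

Two pairs give the same distribution exactly when they are equivalent (`toSimplex_eq_iff`).
Consecutive ratios recover `γ`, and at a genuine drop from a positive value `aᵢ` is a superlevel
set. Where `γᵢ = 0`, or after the first `1`, the choice of `aᵢ` has no effect on the values.

For a common ordering, the Bayesian inequality between neighbours says that the drops of `x` are at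
most those of `y`, which is the order on pairs with a common chain. Hence the bijection preserves
and reflects the relations. Transitivity is hard to see on classes, since the two representatives of
the middle class may differ. It is proved for distributions, through the permutation-free criterion
`bayesLE_iff_precedes`, and transported back. -/

namespace EntropicGeometry

/-! ### The Bayesian order as a pairwise condition -/

section Bayes

variable {ι : Type*}

/-- `k` precedes `l` for the pair `(x, y)`: both functions decrease from `k` to `l`, and `y` does so
at least as fast as `x`. -/
def Precedes (x y : ι → ℝ) (k l : ι) : Prop :=
  x l ≤ x k ∧ y l ≤ y k ∧ x k * y l ≤ x l * y k

/-- Along a common decreasing enumeration, the inequality between neighbours propagates to all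
pairs of positions. -/
theorem mul_le_mul_of_adjacent {n : ℕ} {u v : Fin n → ℝ} (hu0 : ∀ i, 0 ≤ u i)
    (hu : Antitone u) (hv : Antitone v)
    (h : ∀ i j : Fin n, j.1 = i.1 + 1 → u i * v j ≤ u j * v i) {i j : Fin n} (hij : i ≤ j) :
    u i * v j ≤ u j * v i := by
  obtain ⟨d, hd⟩ : ∃ d, j.1 = i.1 + d := ⟨j.1 - i.1, by have := Fin.le_def.1 hij; omega⟩
  induction d generalizing j with
  | zero =>
    obtain rfl : i = j := Fin.ext (by omega)
    exact le_rfl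
  | succ d ih =>
    have hj := j.2
    let k : Fin n := ⟨i.1 + d, by omega⟩
    have hik : i ≤ k := Fin.le_def.2 (by simp [k])
    have hkj : k ≤ j := Fin.le_def.2 (by simp only [k]; omega)
    have h1 := ih hik rfl
    have h2 := h k j (by simp only [k]; omega)
    -- The middle factor `u k` can be cancelled only if it is positive; if it vanishes, so does `u
    -- j`, and `h1` kills the left side.
    rcases (hu0 k).eq_or_lt with hk | hk
    · have hj0 : u j = 0 := le_antisymm ((hu hkj).trans hk.ge) (hu0 j)
      rw [← hk, zero_mul] at h1
      rw [hj0, zero_mul]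
      exact (mul_le_mul_of_nonneg_left (hv hkj) (hu0 i)).trans h1
    · refine le_of_mul_le_mul_left ?_ hk
      calc u k * (u i * v j) = u i * (u k * v j) := by ring
        _ ≤ u i * (u j * v k) := mul_le_mul_of_nonneg_left h2 (hu0 i)
        _ = u j * (u i * v k) := by ring
        _ ≤ u j * (u k * v i) := mul_le_mul_of_nonneg_left h1 (hu0 j)
        _ = u k * (u j * v i) := by ring

theorem bayesLE_iff_precedes {n : ℕ} {x y : stdSimplex ℝ (Fin n)} :
    bayesLE n x y ↔ ∀ k l, Precedes x.1 y.1 k l ∨ Precedes x.1 y.1 l k := by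
  constructor
  · rintro ⟨σ, hx, hy, h⟩
    have key : ∀ i j, i ≤ j → Precedes x.1 y.1 (σ i) (σ j) := fun i j hij =>
      ⟨hx hij, hy hij, mul_le_mul_of_adjacent (u := x.1 ∘ σ) (v := y.1 ∘ σ)
        (fun i => x.2.1 _) hx hy h hij⟩
    intro k l
    obtain ⟨i, rfl⟩ := σ.surjective k
    obtain ⟨j, rfl⟩ := σ.surjective l
    exact (le_total i j).imp (key i j) (key j i)
  · intro h
    -- Sorting decreasingly by `x`, with ties broken by `y`, makes both functions decrease. A pair
    -- related only in the opposite direction must then be tied in both.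
    let f : Fin n → (ℝ ×ₗ ℝ)ᵒᵈ := fun k => OrderDual.toDual (toLex (x.1 k, y.1 k))
    have hf := Tuple.monotone_sort f
    have key : ∀ i j, i ≤ j → Precedes x.1 y.1 (Tuple.sort f i) (Tuple.sort f j) := by
      intro i j hij
      have := hf hij
      simp only [Function.comp, f, OrderDual.toDual_le_toDual, Prod.Lex.toLex_le_toLex] at this
      rcases h (Tuple.sort f i) (Tuple.sort f j) with h' | ⟨h1, h2, h3⟩
      · exact h'
      · rcases this with hlt | ⟨he, hle⟩
        · exact absurd hlt h1.not_gt
        · have he' := le_antisymm h2 hle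
          exact ⟨he.le, hle, by rw [he, he']⟩
    exact ⟨Tuple.sort f, fun i j hij => (key i j hij).1, fun i j hij => (key i j hij).2.1,
      fun i j hij => (key i j (Fin.le_def.2 (by omega))).2.2⟩

section Pairwise

variable {n : ℕ} {x y z : stdSimplex ℝ (Fin n)}

theorem exists_pos_of_mem_stdSimplex (x : stdSimplex ℝ (Fin n)) : ∃ k, 0 < x.1 k := by
  by_contra! h
  have := x.2.2
  rw [Finset.sum_eq_zero fun k _ => le_antisymm (h k) (x.2.1 k)] at this
  exact zero_ne_one this

theorem mul_le_mul_of_lt (h : ∀ k l, Precedes x.1 y.1 k l ∨ Precedes x.1 y.1 l k) {k l : Fin n}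
    (hkl : x.1 l < x.1 k) : y.1 l ≤ y.1 k ∧ x.1 k * y.1 l ≤ x.1 l * y.1 k := by
  rcases h k l with h | h
  · exact h.2
  · exact absurd hkl h.1.not_gt

/-- Passing to a larger distribution shrinks the support. -/
theorem eq_zero_of_precedes (h : ∀ k l, Precedes x.1 y.1 k l ∨ Precedes x.1 y.1 l k) {k : Fin n}
    (hk : x.1 k = 0) : y.1 k = 0 := by
  obtain ⟨m, hm⟩ := exists_pos_of_mem_stdSimplex x
  have := (mul_le_mul_of_lt h (k := m) (l := k) (by rwa [hk])).2
  rw [hk, zero_mul] at this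
  exact le_antisymm (nonpos_of_mul_nonpos_right this hm) (y.2.1 k)

/-- Strict inequalities persist as long as the value stays positive. -/
theorem eq_zero_or_lt_of_lt (h : ∀ k l, Precedes x.1 y.1 k l ∨ Precedes x.1 y.1 l k)
    {k l : Fin n} (hkl : x.1 l < x.1 k) : (y.1 k = 0 ∧ y.1 l = 0) ∨ y.1 l < y.1 k := by
  obtain ⟨h1, h2⟩ := mul_le_mul_of_lt h hkl
  rcases h1.eq_or_lt with he | hlt
  · left
    have : y.1 k = 0 := by
      rw [he] at h2
      by_contra hne
      have hpos : 0 < y.1 k := lt_of_le_of_ne (y.2.1 k) (Ne.symm hne)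
      exact absurd (le_of_mul_le_mul_right h2 hpos) hkl.not_ge
    exact ⟨this, he.trans this⟩
  · exact Or.inr hlt

/-- If `x` is strict on a pair, then either `y` is strict too and the inequalities multiply, or `y`
and hence `z` vanish at both points. If `x` is tied, `z` decides the direction. -/
theorem precedes_trans (h : ∀ k l, Precedes x.1 y.1 k l ∨ Precedes x.1 y.1 l k)
    (h' : ∀ k l, Precedes y.1 z.1 k l ∨ Precedes y.1 z.1 l k) (k l : Fin n) :
    Precedes x.1 z.1 k l ∨ Precedes x.1 z.1 l k := by
  have key : ∀ {k l}, x.1 l < x.1 k → Precedes x.1 z.1 k l := by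
    intro k l hkl
    rcases eq_zero_or_lt_of_lt h hkl with ⟨hk, hl⟩ | hlt
    · have hk' := eq_zero_of_precedes h' hk
      have hl' := eq_zero_of_precedes h' hl
      exact ⟨hkl.le, by rw [hk', hl'], by rw [hk', hl', mul_zero, mul_zero]⟩
    · obtain ⟨h1, h2⟩ := mul_le_mul_of_lt h' hlt
      refine ⟨hkl.le, h1, le_of_mul_le_mul_left ?_ ((y.2.1 l).trans_lt hlt)⟩
      calc y.1 k * (x.1 k * z.1 l) = x.1 k * (y.1 k * z.1 l) := by ring
        _ ≤ x.1 k * (y.1 l * z.1 k) := mul_le_mul_of_nonneg_left h2 (x.2.1 k)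
        _ = (x.1 k * y.1 l) * z.1 k := by ring
        _ ≤ (x.1 l * y.1 k) * z.1 k :=
          mul_le_mul_of_nonneg_right (mul_le_mul_of_lt h hkl).2 (z.2.1 k)
        _ = y.1 k * (x.1 l * z.1 k) := by ring
  rcases lt_trichotomy (x.1 k) (x.1 l) with hlt | he | hlt
  · exact Or.inr (key hlt)
  · refine (le_total (z.1 l) (z.1 k)).imp (fun hz => ⟨he.ge, hz, ?_⟩) (fun hz => ⟨he.le, hz, ?_⟩)
    · rw [he]; exact mul_le_mul_of_nonneg_left hz (x.2.1 l)
    · rw [he]; exact mul_le_mul_of_nonneg_left hz (x.2.1 l)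
  · exact Or.inl (key hlt)

/-- All cross products `x k * y l = x l * y k` agree, so the two functions are proportional; both
have sum one. -/
theorem eq_of_precedes (h : ∀ k l, Precedes x.1 y.1 k l ∨ Precedes x.1 y.1 l k)
    (h' : ∀ k l, Precedes y.1 x.1 k l ∨ Precedes y.1 x.1 l k) : x = y := by
  have key : ∀ {k l}, x.1 l < x.1 k → x.1 k * y.1 l = x.1 l * y.1 k := by
    intro k l hkl
    rcases eq_zero_or_lt_of_lt h hkl with ⟨hk, hl⟩ | hlt
    · rw [hk, hl, mul_zero, mul_zero]
    · refine le_antisymm (mul_le_mul_of_lt h hkl).2 ?_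
      have := (mul_le_mul_of_lt h' hlt).2
      linarith
  have aux : ∀ {k l}, x.1 k = x.1 l → y.1 k ≤ y.1 l := by
    intro k l he
    by_contra! hlt
    rcases eq_zero_or_lt_of_lt h' hlt with ⟨hk, _⟩ | hlt'
    · have := eq_zero_of_precedes h hk
      exact absurd (y.2.1 l) (by rw [this] at hlt; exact hlt.not_ge)
    · exact absurd he hlt'.ne'
  have cross : ∀ k l, x.1 k * y.1 l = x.1 l * y.1 k := by
    intro k l
    rcases lt_trichotomy (x.1 k) (x.1 l) with hlt | he | hlt
    · exact (key hlt).symm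
    · rw [he, le_antisymm (aux he) (aux he.symm)]
    · exact key hlt
  refine Subtype.ext (funext fun k => ?_)
  calc x.1 k = ∑ l, x.1 k * y.1 l := by rw [← Finset.mul_sum, y.2.2, mul_one]
    _ = ∑ l, x.1 l * y.1 k := Finset.sum_congr rfl fun l _ => cross k l
    _ = y.1 k := by rw [← Finset.sum_mul, x.2.2, one_mul]

end Pairwise

theorem isPartialOrder_bayesLE (n : ℕ) : IsPartialOrder (stdSimplex ℝ (Fin n)) (bayesLE n) where
  refl x := bayesLE_iff_precedes.2 fun k l =>
    (le_total (x.1 l) (x.1 k)).imp (fun h => ⟨h, h, (mul_comm _ _).le⟩)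
      (fun h => ⟨h, h, (mul_comm _ _).le⟩)
  trans _ _ _ h h' := bayesLE_iff_precedes.2
    (precedes_trans (bayesLE_iff_precedes.1 h) (bayesLE_iff_precedes.1 h'))
  antisymm _ _ h h' := eq_of_precedes (bayesLE_iff_precedes.1 h) (bayesLE_iff_precedes.1 h')

end Bayes

/-! ### Maximal chains of proper subsets -/

section Chains

variable {m : ℕ}

/-- The subset underlying an element of the dual poset of proper subsets. -/
def toFinset (t : ProperDual (Finset (Fin (m + 1)))) : Finset (Fin (m + 1)) :=
  (OrderDual.ofDual t).1

theorem toFinset_injective :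
    Function.Injective (toFinset : ProperDual (Finset (Fin (m + 1))) → _) :=
  fun _ _ h => OrderDual.ofDual.injective (Subtype.ext h)

theorem le_iff_toFinset_subset {s t : ProperDual (Finset (Fin (m + 1)))} :
    s ≤ t ↔ toFinset t ⊆ toFinset s := Iff.rfl

theorem lt_iff_toFinset_ssubset {s t : ProperDual (Finset (Fin (m + 1)))} :
    s < t ↔ toFinset t ⊂ toFinset s := Iff.rfl

theorem card_toFinset_pos (t : ProperDual (Finset (Fin (m + 1)))) : 0 < (toFinset t).card :=
  Finset.card_pos.2 (Finset.nonempty_iff_ne_empty.2 (OrderDual.ofDual t).2.1)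

theorem card_toFinset_lt (t : ProperDual (Finset (Fin (m + 1)))) : (toFinset t).card < m + 1 := by
  have := (Finset.card_lt_iff_ne_univ (toFinset t)).2 (OrderDual.ofDual t).2.2
  simpa using this

/-- A set whose cardinality lies strictly between `0` and `m + 1` is an element of the poset. -/
theorem exists_toFinset_eq {u : Finset (Fin (m + 1))} (h0 : 0 < u.card) (h1 : u.card < m + 1) :
    ∃ t : ProperDual (Finset (Fin (m + 1))), toFinset t = u := by
  refine ⟨OrderDual.toDual ⟨u, ?_, ?_⟩, rfl⟩
  · rintro rfl
    simp at h0
  · rintro rfl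
    simp at h1

theorem eq_of_comparable_of_card_eq {s t : ProperDual (Finset (Fin (m + 1)))}
    (h : s ≤ t ∨ t ≤ s) (hc : (toFinset s).card = (toFinset t).card) : s = t := by
  apply toFinset_injective
  rcases h with h | h
  · exact (Finset.eq_of_subset_of_card_le (le_iff_toFinset_subset.1 h) hc.le).symm
  · exact Finset.eq_of_subset_of_card_le (le_iff_toFinset_subset.1 h) hc.ge

/-- A chain of finite sets with members below and above cardinality `k` admits a set of cardinality
`k` comparable to all its members. -/
theorem exists_comparable_of_card {α : Type*} {T : Set (Finset α)} (hT : IsChain (· ⊆ ·) T) {k : ℕ}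
    (h0 : ∃ t ∈ T, t.card ≤ k) (h1 : ∃ t ∈ T, k ≤ t.card) :
    ∃ u : Finset α, u.card = k ∧ ∀ t ∈ T, t ⊆ u ∨ u ⊆ t := by
  classical
  obtain ⟨b, ⟨hbT, hbk⟩, hbmax⟩ : ∃ b ∈ {t | t ∈ T ∧ t.card ≤ k},
      ∀ t ∈ {t | t ∈ T ∧ t.card ≤ k}, t.card ≤ b.card := by
    have hne : (Finset.card '' {t | t ∈ T ∧ t.card ≤ k}).Nonempty := Set.Nonempty.image _ h0
    have hbd : BddAbove (Finset.card '' {t | t ∈ T ∧ t.card ≤ k}) :=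
      ⟨k, by rintro _ ⟨t, ht, rfl⟩; exact ht.2⟩
    obtain ⟨b, hb, hbe⟩ := Nat.sSup_mem hne hbd
    exact ⟨b, hb, fun t ht => hbe ▸ le_csSup hbd ⟨t, ht, rfl⟩⟩
  obtain ⟨c, ⟨hcT, hck⟩, hcmin⟩ : ∃ c ∈ {t | t ∈ T ∧ k ≤ t.card},
      ∀ t ∈ {t | t ∈ T ∧ k ≤ t.card}, c.card ≤ t.card := by
    have hne : (Finset.card '' {t | t ∈ T ∧ k ≤ t.card}).Nonempty := Set.Nonempty.image _ h1
    obtain ⟨c, hc, hce⟩ := Nat.sInf_mem hne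
    exact ⟨c, hc, fun t ht => hce ▸ Nat.sInf_le ⟨t, ht, rfl⟩⟩
  have sub : ∀ {s t}, s ∈ T → t ∈ T → s.card ≤ t.card → s ⊆ t := by
    intro s t hs ht hc
    rcases hT.total hs ht with h | h
    · exact h
    · exact (Finset.eq_of_subset_of_card_le h hc).ge
  obtain ⟨u, hbu, huc, hu⟩ :=
    Finset.exists_subsuperset_card_eq (sub hbT hcT (hbk.trans hck)) hbk hck
  refine ⟨u, hu, fun t ht => ?_⟩
  rcases le_total t.card k with h | h
  · exact Or.inl ((sub ht hbT (hbmax t ⟨ht, h⟩)).trans hbu)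
  · exact Or.inr (huc.trans (sub hcT ht (hcmin t ⟨ht, h⟩)))

theorem exists_mem_card_eq {s : Set (ProperDual (Finset (Fin (m + 1))))}
    (hs : IsMaxChain (· ≤ ·) s) (i : Fin m) : ∃ t ∈ s, (toFinset t).card = i + 1 := by
  -- Adjoining `∅` and the full set supplies members below and above every size; maximality then
  -- absorbs the comparable set of size `i + 1`.
  have hT : IsChain (· ⊆ ·) (insert ∅ (insert Finset.univ (toFinset '' s))) := by
    refine IsChain.insert (IsChain.insert ?_ ?_) ?_
    · rintro _ ⟨a, ha, rfl⟩ _ ⟨b, hb, rfl⟩ -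
      exact (hs.1.total ha hb).symm
    · intro b _ _
      exact Or.inr (Finset.subset_univ b)
    · intro b _ _
      exact Or.inl (Finset.empty_subset b)
  obtain ⟨u, hu, hcomp⟩ := exists_comparable_of_card hT (k := i + 1)
    ⟨∅, by simp, by simp⟩ ⟨Finset.univ, by simp, by simp⟩
  obtain ⟨t, rfl⟩ := exists_toFinset_eq (u := u) (by omega) (by omega)
  refine ⟨t, ?_, hu⟩
  have hins : IsChain (· ≤ ·) (insert t s) := hs.1.insert fun b hb _ =>
    hcomp _ (Set.mem_insert_of_mem _ (Set.mem_insert_of_mem _ ⟨b, hb, rfl⟩))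
  rw [hs.2 hins (Set.subset_insert t s)]
  exact Set.mem_insert t s

/-- A maximal chain of proper subsets has a decreasing enumeration whose `i`-th member has `i + 1`
elements. -/
theorem exists_enumeration {s : Set (ProperDual (Finset (Fin (m + 1))))}
    (hs : IsMaxChain (· ≤ ·) s) :
    ∃ c : Fin m → ProperDual (Finset (Fin (m + 1))), StrictAnti c ∧ Set.range c = s ∧
      ∀ i, (toFinset (c i)).card = i + 1 := by
  choose c hcs hc using exists_mem_card_eq hs
  refine ⟨c, fun i j hij => ?_, ?_, hc⟩
  · have hlt : (toFinset (c i)).card < (toFinset (c j)).card := by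
      rw [hc, hc]
      simpa using hij
    rcases hs.1.total (hcs i) (hcs j) with h | h
    · exact absurd (Finset.card_le_card (le_iff_toFinset_subset.1 h)) hlt.not_ge
    · exact lt_of_le_of_ne h fun he => hlt.ne (by rw [he])
  · refine Set.Subset.antisymm (Set.range_subset_iff.2 hcs) fun t ht => ?_
    have h0 := card_toFinset_pos t
    have h1 := card_toFinset_lt t
    let i : Fin m := ⟨(toFinset t).card - 1, by omega⟩
    refine ⟨i, eq_of_comparable_of_card_eq (hs.1.total (hcs i) ht) ?_⟩
    rw [hc]
    simp only [i]
    omega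

theorem existsUnique_enumeration (s : Set (ProperDual (Finset (Fin (m + 1)))))
    (hs : IsMaxChain (· ≤ ·) s) :
    ∃! a : MChain (Finset (Fin (m + 1))) m, Set.range a.1 = s := by
  obtain ⟨c, hc, hcs, -⟩ := exists_enumeration hs
  refine ⟨⟨c, hc, by rwa [hcs]⟩, hcs, fun a ha => Subtype.ext ?_⟩
  exact (a.2.1.range_inj hc).1 (ha.trans hcs.symm)

theorem card_toFinset_mChain (a : MChain (Finset (Fin (m + 1))) m) (i : Fin m) :
    (toFinset (a.1 i)).card = i + 1 := by
  obtain ⟨c, hc, hcs, hcard⟩ := exists_enumeration a.2.2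
  rw [(a.2.1.range_inj hc).1 hcs.symm, hcard]

/-- The enumeration `σ` of the points lists the members of the chain `a` as its initial segments. -/
def Enumerates (σ : Equiv.Perm (Fin (m + 1))) (a : MChain (Finset (Fin (m + 1))) m) : Prop :=
  ∀ (i : Fin m) (j : Fin (m + 1)), σ j ∈ toFinset (a.1 i) ↔ j ≤ i.castSucc

theorem exists_enumerates_of_perm (σ : Equiv.Perm (Fin (m + 1))) :
    ∃ a : MChain (Finset (Fin (m + 1))) m, Enumerates σ a := by
  have hcard : ∀ i : Fin m, ((Finset.Iic i.castSucc).map σ.toEmbedding).card = i + 1 := by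
    intro i
    simp
  have := fun i : Fin m => exists_toFinset_eq (u := (Finset.Iic i.castSucc).map σ.toEmbedding)
    (by rw [hcard]; omega) (by rw [hcard]; omega)
  choose c hc using this
  have hmem : ∀ (i : Fin m) (j : Fin (m + 1)), σ j ∈ toFinset (c i) ↔ j ≤ i.castSucc := by
    intro i j
    simp [hc]
  have hanti : StrictAnti c := by
    intro i j hij
    rw [lt_iff_toFinset_ssubset, hc, hc, Finset.map_ssubset_map, Finset.Iic_ssubset_Iic]
    simpa using hij
  refine ⟨⟨c, hanti, ?_, ?_⟩, hmem⟩
  · rintro _ ⟨i, rfl⟩ _ ⟨j, rfl⟩ -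
    exact (le_total j i).imp (fun h => hanti.antitone h) (fun h => hanti.antitone h)
  · intro t ht hsub
    refine hsub.antisymm fun u hu => ?_
    have h0 := card_toFinset_pos u
    have h1 := card_toFinset_lt u
    let i : Fin m := ⟨(toFinset u).card - 1, by omega⟩
    refine ⟨i, eq_of_comparable_of_card_eq (ht.total (hsub ⟨i, rfl⟩) hu) ?_⟩
    rw [hc, hcard]
    simp only [i]
    omega

theorem exists_enumerates (a : MChain (Finset (Fin (m + 1))) m) :
    ∃ σ : Equiv.Perm (Fin (m + 1)), Enumerates σ a := by
  classical
  have hmono : ∀ {i j}, i ≤ j → toFinset (a.1 i) ⊆ toFinset (a.1 j) := fun h =>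
    le_iff_toFinset_subset.1 (a.2.1.antitone h)
  -- the rank of a point is the number of members of the chain that omit it
  let r : Fin (m + 1) → ℕ := fun k => (Finset.univ.filter fun i => k ∉ toFinset (a.1 i)).card
  have hr : ∀ (i : Fin m) (k), k ∈ toFinset (a.1 i) ↔ r k ≤ i := by
    intro i k
    constructor
    · intro hk
      refine (Finset.card_le_card (t := Finset.Iio i) fun j hj => ?_).trans (by simp)
      rw [Finset.mem_Iio]
      by_contra! hij
      exact (Finset.mem_filter.1 hj).2 (hmono hij hk)
    · intro hk
      by_contra hki
      have : (Finset.Iic i).card ≤ r k := Finset.card_le_card fun j hj =>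
        Finset.mem_filter.2 ⟨Finset.mem_univ j, fun h => hki (hmono (Finset.mem_Iic.1 hj) h)⟩
      simp at this
      omega
  have hrm : ∀ k, r k ≤ m := fun k => (Finset.card_le_univ _).trans (by simp)
  have hcount : ∀ j ≤ m + 1, (Finset.univ.filter fun k => r k < j).card = j := by
    intro j hj
    -- Strictly between the extremes, the points of rank below `j` form the chain member of index `j
    -- - 1`, which has `j` elements.
    rcases Nat.eq_zero_or_pos j with rfl | hj0
    · simp
    rcases hj.eq_or_lt with rfl | hlt
    · rw [Finset.filter_true_of_mem fun k _ => Nat.lt_succ_of_le (hrm k)]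
      simp
    · have := card_toFinset_mChain a ⟨j - 1, by omega⟩
      have he : toFinset (a.1 ⟨j - 1, by omega⟩) = Finset.univ.filter fun k => r k < j := by
        ext k
        rw [hr, Finset.mem_filter]
        simp only [Finset.mem_univ, true_and]
        omega
      rw [he] at this
      simp only at this
      omega
  have hinj : Function.Injective fun k => (⟨r k, Nat.lt_succ_of_le (hrm k)⟩ : Fin (m + 1)) := by
    intro k l hkl
    have hkl : r k = r l := congrArg Fin.val hkl
    by_contra hne
    -- Two points of equal rank `r k` would give at least `r k + 2` points of rank below `r k + 1`.
    have hsub : insert k (insert l (Finset.univ.filter fun x => r x < r k)) ⊆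
        Finset.univ.filter fun x => r x < r k + 1 := by
      intro x
      simp only [Finset.mem_insert, Finset.mem_filter, Finset.mem_univ, true_and]
      rintro (rfl | rfl | h) <;> omega
    have hle := Finset.card_le_card hsub
    rw [Finset.card_insert_of_notMem (by simp [hne]), Finset.card_insert_of_notMem (by simp [hkl]),
      hcount _ (by have := hrm k; omega), hcount _ (by have := hrm k; omega)] at hle
    omega
  let e := Equiv.ofBijective _ (Finite.injective_iff_bijective.1 hinj)
  refine ⟨e.symm, fun i j => ?_⟩
  have he : r (e.symm j) = j := congrArg Fin.val (e.apply_symm_apply j)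
  rw [hr, he, Fin.le_def, Fin.val_castSucc]

end Chains

/-! ### From pairs to distributions -/

section Weight

variable {m : ℕ}

/-- The unnormalized distribution of a pair `a · γ`: passing from `aᵢ` to its complement
multiplies the value by `1 - γᵢ`. -/
noncomputable def weight (p : Pairs (Finset (Fin (m + 1))) unitInterval m) (k : Fin (m + 1)) : ℝ :=
  ∏ i, if k ∈ toFinset (p.1.1 i) then 1 else 1 - (p.2.1 i : ℝ)

variable {p q : Pairs (Finset (Fin (m + 1))) unitInterval m} {σ : Equiv.Perm (Fin (m + 1))}

theorem weight_nonneg (p : Pairs (Finset (Fin (m + 1))) unitInterval m) (k : Fin (m + 1)) :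
    0 ≤ weight p k := by
  refine Finset.prod_nonneg fun i _ => ?_
  split_ifs
  · exact zero_le_one
  · exact sub_nonneg.2 (p.2.1 i).2.2

theorem weight_zero (h : Enumerates σ p.1) : weight p (σ 0) = 1 :=
  Finset.prod_eq_one fun i _ => if_pos ((h i 0).2 (Fin.zero_le _))

/-- Consecutive points of the enumeration are separated by `aᵢ` alone, so only the factor at `i`
changes. -/
theorem weight_succ (h : Enumerates σ p.1) (i : Fin m) :
    weight p (σ i.succ) = weight p (σ i.castSucc) * (1 - (p.2.1 i : ℝ)) := by
  have : (1 - (p.2.1 i : ℝ)) = ∏ j, if j = i then 1 - (p.2.1 j : ℝ) else 1 := by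
    rw [Finset.prod_ite_eq' Finset.univ i, if_pos (Finset.mem_univ i)]
  rw [weight, weight, this, ← Finset.prod_mul_distrib]
  refine Finset.prod_congr rfl fun j _ => ?_
  simp only [h j _, Fin.castSucc_le_castSucc_iff, Fin.succ_le_castSucc_iff]
  rcases lt_trichotomy i j with hij | rfl | hij
  · rw [if_pos hij, if_pos hij.le, if_neg hij.ne', one_mul]
  · rw [if_neg (lt_irrefl _), if_pos le_rfl, if_pos rfl, one_mul]
  · rw [if_neg hij.not_gt, if_neg hij.not_ge, if_neg hij.ne, mul_one]

theorem sum_weight_pos (p : Pairs (Finset (Fin (m + 1))) unitInterval m) :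
    0 < ∑ k, weight p k := by
  obtain ⟨σ, hσ⟩ := exists_enumerates p.1
  refine Finset.sum_pos' (fun k _ => weight_nonneg p k) ⟨σ 0, Finset.mem_univ _, ?_⟩
  rw [weight_zero hσ]
  exact one_pos

/-- The distribution of a pair `a · γ`. -/
noncomputable def toSimplex (p : Pairs (Finset (Fin (m + 1))) unitInterval m) :
    stdSimplex ℝ (Fin (m + 1)) :=
  ⟨fun k => weight p k / ∑ l, weight p l,
    fun k => div_nonneg (weight_nonneg p k) (sum_weight_pos p).le, by
      rw [← Finset.sum_div, div_self (sum_weight_pos p).ne']⟩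

theorem toSimplex_zero_pos (h : Enumerates σ p.1) : 0 < (toSimplex p).1 (σ 0) := by
  refine div_pos ?_ (sum_weight_pos p)
  rw [weight_zero h]
  exact one_pos

theorem toSimplex_succ (h : Enumerates σ p.1) (i : Fin m) :
    (toSimplex p).1 (σ i.succ) = (toSimplex p).1 (σ i.castSucc) * (1 - (p.2.1 i : ℝ)) := by
  simp only [toSimplex]
  rw [weight_succ h, mul_div_right_comm]

theorem antitone_toSimplex (h : Enumerates σ p.1) : Antitone ((toSimplex p).1 ∘ σ) := by
  refine Fin.antitone_iff_succ_le.2 fun i => ?_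
  simp only [Function.comp]
  rw [toSimplex_succ h]
  exact mul_le_of_le_one_right ((toSimplex p).2.1 _) (sub_le_self _ (p.2.1 i).2.1)

theorem exists_eq_top_of_toSimplex_eq_zero (h : Enumerates σ p.1) {j : Fin (m + 1)}
    (hj : (toSimplex p).1 (σ j) = 0) : ∃ i : Fin m, i.castSucc < j ∧ p.2.1 i = ⊤ := by
  induction j using Fin.induction with
  | zero => exact absurd hj (toSimplex_zero_pos h).ne'
  | succ i ih =>
    rw [toSimplex_succ h, mul_eq_zero] at hj
    rcases hj with hj | hj
    · obtain ⟨k, hk, hk'⟩ := ih hj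
      exact ⟨k, hk.trans Fin.castSucc_lt_succ, hk'⟩
    · exact ⟨i, Fin.castSucc_lt_succ, Subtype.ext (sub_eq_zero.1 hj).symm⟩

theorem eq_top_of_toSimplex_eq_zero (h : Enumerates σ p.1) {i : Fin m}
    (hi : (toSimplex p).1 (σ i.castSucc) = 0) : p.2.1 i = ⊤ := by
  obtain ⟨k, hk, hk'⟩ := exists_eq_top_of_toSimplex_eq_zero h hi
  exact p.2.2 k i hk hk'

/-- The tuple is recovered from the ratios of consecutive values. -/
theorem coe_tuple_eq (h : Enumerates σ p.1) (i : Fin m) :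
    (p.2.1 i : ℝ) = 1 - (toSimplex p).1 (σ i.succ) / (toSimplex p).1 (σ i.castSucc) := by
  by_cases hi : (toSimplex p).1 (σ i.castSucc) = 0
  -- Beyond the support, `x / 0 = 0` makes the right side `1`, matching the `⊤`-closedness of the
  -- tuple.
  · rw [hi, div_zero, sub_zero, eq_top_of_toSimplex_eq_zero h hi]
    rfl
  · rw [toSimplex_succ h, mul_div_cancel_left₀ _ hi, sub_sub_cancel]

theorem toSimplex_succ_lt (h : Enumerates σ p.1) {i : Fin m} (hi : i ∈ activeIndices p.2) :
    (toSimplex p).1 (σ i.succ) < (toSimplex p).1 (σ i.castSucc) := by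
  have hpos : 0 < (toSimplex p).1 (σ i.castSucc) := by
    refine lt_of_le_of_ne ((toSimplex p).2.1 _) fun h0 => ?_
    rcases hi with hi | hi
    · exact hi.2 (eq_top_of_toSimplex_eq_zero h h0.symm)
    · obtain ⟨k, hk, hk'⟩ := exists_eq_top_of_toSimplex_eq_zero h h0.symm
      exact absurd (hi.2 hk') (not_le_of_gt (Fin.castSucc_lt_castSucc_iff.1 hk))
  have hne : p.2.1 i ≠ ⊥ := by
    rcases hi with hi | hi
    · exact hi.1
    · rw [show p.2.1 i = ⊤ from hi.1]
      exact top_ne_bot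
  have hγ : 0 < (p.2.1 i : ℝ) := lt_of_le_of_ne (p.2.1 i).2.1 fun h0 => hne (Subtype.ext h0.symm)
  rw [toSimplex_succ h]
  exact mul_lt_of_lt_one_right hpos (sub_lt_self _ hγ)

/-- At the active indices the chain consists of the superlevel sets of the distribution. -/
theorem mem_chain_iff (h : Enumerates σ p.1) {i : Fin m} (hi : i ∈ activeIndices p.2)
    (k : Fin (m + 1)) :
    k ∈ toFinset (p.1.1 i) ↔ (toSimplex p).1 (σ i.castSucc) ≤ (toSimplex p).1 k := by
  obtain ⟨j, rfl⟩ := σ.surjective k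
  rw [h i j]
  refine ⟨fun hj => antitone_toSimplex h hj, fun hj => ?_⟩
  by_contra! hlt
  have : (toSimplex p).1 (σ j) ≤ (toSimplex p).1 (σ i.succ) :=
    antitone_toSimplex h (Fin.castSucc_lt_iff_succ_le.1 hlt)
  exact absurd (hj.trans this) (toSimplex_succ_lt h hi).not_ge

/-- Factors with `γᵢ = 0` are `1` whatever `aᵢ` is. At the first `γᵢ = 1` the chains agree: points
outside that set have weight zero, and points inside it lie in all later members of both chains. -/
theorem weight_congr (h : voidSetoid (Finset (Fin (m + 1))) unitInterval m p q) :
    weight p = weight q := by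
  obtain ⟨hγ, ha⟩ := h
  ext k
  by_cases hk : ∃ i, IsLeast {j | p.2.1 j = ⊤} i ∧ k ∉ toFinset (p.1.1 i)
  · obtain ⟨i, hi, hki⟩ := hk
    have hp : p.2.1 i = ⊤ := hi.1
    have hq : q.2.1 i = ⊤ := hγ ▸ hp
    have hki' : k ∉ toFinset (q.1.1 i) := ha i (Or.inr hi) ▸ hki
    rw [weight, weight, Finset.prod_eq_zero (Finset.mem_univ i),
      Finset.prod_eq_zero (Finset.mem_univ i)]
    · rw [if_neg hki', hq]
      exact sub_self 1
    · rw [if_neg hki, hp]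
      exact sub_self 1
  · push Not at hk
    refine Finset.prod_congr rfl fun i _ => ?_
    rw [← hγ]
    by_cases h0 : p.2.1 i = ⊥
    · simp [h0]
    by_cases h1 : p.2.1 i = ⊤
    · obtain ⟨j, hj⟩ : ∃ j, IsLeast {j | p.2.1 j = ⊤} j := by
        obtain ⟨j, hj, hmin⟩ := Finset.exists_minimal
          (s := Finset.univ.filter fun j => p.2.1 j = ⊤) ⟨i, by simpa using h1⟩
        refine ⟨j, by simpa using hj, fun l hl => ?_⟩
        exact (le_total j l).elim id fun h => hmin (by simpa using hl) h
      have hji : j ≤ i := hj.2 h1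
      have hkp := hk j hj
      have hkq : k ∈ toFinset (q.1.1 j) := ha j (Or.inr hj) ▸ hkp
      rw [if_pos (le_iff_toFinset_subset.1 (p.1.2.1.antitone hji) hkp),
        if_pos (le_iff_toFinset_subset.1 (q.1.2.1.antitone hji) hkq)]
    · rw [ha i (Or.inl ⟨h0, h1⟩)]

theorem toSimplex_eq_iff :
    toSimplex p = toSimplex q ↔ voidSetoid (Finset (Fin (m + 1))) unitInterval m p q := by
  constructor
  · intro h
    obtain ⟨σ, hσ⟩ := exists_enumerates p.1
    obtain ⟨τ, hτ⟩ := exists_enumerates q.1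
    -- The enumerations may differ, but the decreasing rearrangement of one function is unique.
    have hv : ∀ j, (toSimplex p).1 (σ j) = (toSimplex q).1 (τ j) := by
      intro j
      have := antitone_toSimplex hτ
      rw [← h] at this ⊢
      exact congrFun (Tuple.unique_antitone (antitone_toSimplex hσ) this) j
    have hγ : p.2 = q.2 := by
      refine Subtype.ext (funext fun i => Subtype.ext ?_)
      rw [coe_tuple_eq hσ, coe_tuple_eq hτ, hv, hv]
    refine ⟨hγ, fun i hi => toFinset_injective (Finset.ext fun k => ?_)⟩
    rw [mem_chain_iff hσ hi, mem_chain_iff hτ (hγ ▸ hi), hv, h]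
  · intro h
    refine Subtype.ext ?_
    simp only [toSimplex, weight_congr h]

end Weight

/-! ### From distributions to pairs -/

section Ratio

variable {m : ℕ} {v : Fin (m + 1) → ℝ}

theorem ratio_mem_unitInterval (h0 : ∀ i, 0 ≤ v i) (hv : Antitone v) (i : Fin m) :
    1 - v i.succ / v i.castSucc ∈ unitInterval :=
  ⟨sub_nonneg.2 (div_le_one_of_le₀ (hv Fin.castSucc_lt_succ.le) (h0 _)),
    sub_le_self _ (div_nonneg (h0 _) (h0 _))⟩

/-- The tuple of relative drops `1 - vᵢ₊₁ / vᵢ` of a decreasing sequence; by the convention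
`x / 0 = 0` it has value `1` beyond the support. -/
noncomputable def drops (v : Fin (m + 1) → ℝ) (h0 : ∀ i, 0 ≤ v i) (hv : Antitone v) :
    ClTop unitInterval m :=
  ⟨fun i => ⟨1 - v i.succ / v i.castSucc, ratio_mem_unitInterval h0 hv i⟩, fun i j hij hi => by
    have hi' : 1 - v i.succ / v i.castSucc = 1 := congrArg Subtype.val hi
    have hzero : v i.succ = 0 := by
      rcases div_eq_zero_iff.1 (show v i.succ / v i.castSucc = 0 by linarith) with h | h
      · exact h
      · exact le_antisymm ((hv Fin.castSucc_lt_succ.le).trans h.le) (h0 _)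
    have hj : v j.castSucc = 0 :=
      le_antisymm ((hv (Fin.succ_le_castSucc_iff.2 hij)).trans hzero.le) (h0 _)
    refine Subtype.ext ?_
    change 1 - v j.succ / v j.castSucc = 1
    rw [hj, div_zero, sub_zero]⟩

theorem toSimplex_drops {x : stdSimplex ℝ (Fin (m + 1))} {σ : Equiv.Perm (Fin (m + 1))}
    (h0 : ∀ i, 0 ≤ (x.1 ∘ σ) i) (hx : Antitone (x.1 ∘ σ))
    {a : MChain (Finset (Fin (m + 1))) m} (ha : Enumerates σ a) :
    toSimplex (a, drops (x.1 ∘ σ) h0 hx) = x := by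
  set p : Pairs (Finset (Fin (m + 1))) unitInterval m := (a, drops (x.1 ∘ σ) h0 hx) with hp
  have hpos : 0 < x.1 (σ 0) := by
    obtain ⟨k, hk⟩ := exists_pos_of_mem_stdSimplex x
    obtain ⟨j, rfl⟩ := σ.surjective k
    exact hk.trans_le (hx (Fin.zero_le j))
  have hw : ∀ j, weight p (σ j) = x.1 (σ j) / x.1 (σ 0) := by
    intro j
    induction j using Fin.induction with
    | zero => rw [weight_zero (p := p) ha, div_self hpos.ne']
    | succ i ih =>
      have hγ : (p.2.1 i : ℝ) = 1 - x.1 (σ i.succ) / x.1 (σ i.castSucc) := rfl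
      rw [weight_succ (p := p) ha, ih, hγ, sub_sub_cancel]
      by_cases hi : x.1 (σ i.castSucc) = 0
      · have : x.1 (σ i.succ) = 0 :=
          le_antisymm ((hx Fin.castSucc_lt_succ.le).trans hi.le) (h0 _)
        rw [hi, this, zero_div, zero_mul]
      · field_simp
  have hw' : ∀ k, weight p k = x.1 k / x.1 (σ 0) := by
    intro k
    obtain ⟨j, rfl⟩ := σ.surjective k
    exact hw j
  have hsum : ∑ k, weight p k = 1 / x.1 (σ 0) := by
    rw [Finset.sum_congr rfl fun k _ => hw' k, ← Finset.sum_div, x.2.2]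
  refine Subtype.ext (funext fun k => ?_)
  simp only [toSimplex]
  rw [hsum, hw', div_div_div_cancel_right₀ hpos.ne', div_one]

theorem drops_le_drops {u v : Fin (m + 1) → ℝ} (hu0 : ∀ i, 0 ≤ u i) (hv0 : ∀ i, 0 ≤ v i)
    (hu : Antitone u) (hv : Antitone v) (hpos : 0 < u 0)
    (h : ∀ i j : Fin (m + 1), j.1 = i.1 + 1 → u i * v j ≤ u j * v i) (i : Fin m) :
    (drops u hu0 hu).1 i ≤ (drops v hv0 hv).1 i := by
  refine Subtype.coe_le_coe.1 (sub_le_sub_left ?_ 1)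
  rcases (hv0 i.castSucc).eq_or_lt with hvi | hvi
  · rw [← hvi, div_zero]
    exact div_nonneg (hu0 _) (hu0 _)
  -- Propagation from position `0` gives `u 0 * v i ≤ u i * v 0`, so the support of `v` lies in that
  -- of `u`.
  have hui : 0 < u i.castSucc := by
    refine lt_of_le_of_ne (hu0 _) fun hui => ?_
    have := mul_le_mul_of_adjacent hu0 hu hv h (Fin.zero_le i.castSucc)
    rw [← hui, zero_mul] at this
    exact absurd (mul_pos hpos hvi) this.not_gt
  rw [div_le_div_iff₀ hvi hui]
  have := h i.castSucc i.succ (by simp)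
  linarith

end Ratio

/-! ### The order isomorphism -/

section Iso

variable {m : ℕ}

theorem bayesLE_toSimplex {p q : Pairs (Finset (Fin (m + 1))) unitInterval m}
    (h : pairLE (Finset (Fin (m + 1))) unitInterval m p q) :
    bayesLE (m + 1) (toSimplex p) (toSimplex q) := by
  obtain ⟨σ, hp⟩ := exists_enumerates p.1
  have hq : Enumerates σ q.1 := h.1 ▸ hp
  refine ⟨σ, antitone_toSimplex hp, antitone_toSimplex hq, fun i j hij => ?_⟩
  have hj := j.2
  obtain ⟨k, rfl⟩ : ∃ k : Fin m, i = k.castSucc := ⟨⟨i.1, by omega⟩, rfl⟩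
  obtain rfl : j = k.succ := Fin.ext hij
  have hle : (p.2.1 k : ℝ) ≤ q.2.1 k := h.2 k
  rw [toSimplex_succ hp, toSimplex_succ hq, mul_right_comm, ← mul_assoc]
  refine mul_le_mul_of_nonneg_left (sub_le_sub_left hle 1) ?_
  exact mul_nonneg ((toSimplex p).2.1 _) ((toSimplex q).2.1 _)

theorem exists_pairLE_of_bayesLE {x y : stdSimplex ℝ (Fin (m + 1))} (h : bayesLE (m + 1) x y) :
    ∃ p q, toSimplex p = x ∧ toSimplex q = y ∧
      pairLE (Finset (Fin (m + 1))) unitInterval m p q := by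
  obtain ⟨σ, hx, hy, h⟩ := h
  obtain ⟨a, ha⟩ := exists_enumerates_of_perm σ
  have hx0 : ∀ i, 0 ≤ (x.1 ∘ σ) i := fun i => x.2.1 _
  have hy0 : ∀ i, 0 ≤ (y.1 ∘ σ) i := fun i => y.2.1 _
  have hpos : 0 < (x.1 ∘ σ) 0 := by
    obtain ⟨k, hk⟩ := exists_pos_of_mem_stdSimplex x
    obtain ⟨j, rfl⟩ := σ.surjective k
    exact hk.trans_le (hx (Fin.zero_le j))
  exact ⟨(a, drops _ hx0 hx), (a, drops _ hy0 hy), toSimplex_drops hx0 hx ha,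
    toSimplex_drops hy0 hy ha, rfl, drops_le_drops hx0 hy0 hx hy hpos h⟩

/-- The distribution of a class of pairs. -/
noncomputable def statesToSimplex :
    States (Finset (Fin (m + 1))) unitInterval m → stdSimplex ℝ (Fin (m + 1)) :=
  Quotient.lift toSimplex fun _ _ h => toSimplex_eq_iff.2 h

theorem statesToSimplex_bijective : Function.Bijective (statesToSimplex (m := m)) := by
  constructor
  · intro X Y
    induction X, Y using Quotient.inductionOn₂ with
    | h p q => exact fun h => Quotient.sound (toSimplex_eq_iff.1 h)
  · intro x
    -- Reflexivity supplies a permutation sorting `x`, from which a preimage is built.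
    obtain ⟨p, -, hp, -⟩ := exists_pairLE_of_bayesLE ((isPartialOrder_bayesLE (m + 1)).refl x)
    exact ⟨Quotient.mk _ p, hp⟩

theorem bayesLE_statesToSimplex_iff {X Y : States (Finset (Fin (m + 1))) unitInterval m} :
    bayesLE (m + 1) (statesToSimplex X) (statesToSimplex Y) ↔
      statesLE (Finset (Fin (m + 1))) unitInterval m X Y := by
  constructor
  · intro h
    obtain ⟨p, q, hp, hq, hpq⟩ := exists_pairLE_of_bayesLE h
    exact ⟨p, q, statesToSimplex_bijective.1 hp, statesToSimplex_bijective.1 hq, hpq⟩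
  · rintro ⟨p, q, rfl, rfl, hpq⟩
    exact bayesLE_toSimplex hpq

/-- The classes of pairs form a poset isomorphic to the distributions with the Bayesian order. -/
noncomputable def statesIso (m : ℕ) :
    statesLE (Finset (Fin (m + 1))) unitInterval m ≃r bayesLE (m + 1) where
  toEquiv := Equiv.ofBijective statesToSimplex statesToSimplex_bijective
  map_rel_iff' := bayesLE_statesToSimplex_iff

end Iso

end EntropicGeometry

open EntropicGeometry in
theorem mainTheorem3 (n : ℕ) (hn : 2 ≤ n) :
    -- every maximal chain has exactly one decreasing enumeration of length `n - 1`
    (∀ s : Set (ProperDual (Finset (Fin n))), IsMaxChain (· ≤ ·) s →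
      ∃! a : MChain (Finset (Fin n)) (n - 1), Set.range a.1 = s) ∧
    -- both relations are partial orders
    IsPartialOrder (States (Finset (Fin n)) unitInterval (n - 1))
      (statesLE (Finset (Fin n)) unitInterval (n - 1)) ∧
    IsPartialOrder (stdSimplex ℝ (Fin n)) (bayesLE n) ∧
    -- the two posets are order-isomorphic
    Nonempty (statesLE (Finset (Fin n)) unitInterval (n - 1) ≃r bayesLE n) := by
  obtain ⟨m, rfl⟩ : ∃ m, n = m + 1 := ⟨n - 1, by omega⟩
  have := isPartialOrder_bayesLE (m + 1)
  exact ⟨existsUnique_enumeration, (statesIso m).toRelEmbedding.isPartialOrder, this,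
    ⟨statesIso m⟩⟩
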